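/- All graphs are finite and simple. Let $t(G)$ denote the number of spanning trees of $G$, $\overline{G}$ its complement, $n(G)$ its number of vertices, and for a positive integer $k$ let $\ell_k(G)=\operatorname{tr}(L(G)^k)$, where $L(G)$ is the Laplacian matrix of $G$. For nonnegative integers $n,m$ let $\mathcal{S}_{n,m}^{(1)}$ be the class of all graphs with $n$ vertices and $m$ edges, and for each $k\ge 1$ let $$\mathcal{S}_{n,m}^{(k+1)}=\{G\in\mathcal{S}_{n,m}^{(k)} : \ell_{k+1}(G)\le \ell_{k+1}(H)\text{ for every }H\in\mathcal{S}_{n,m}^{(k)}\}.$$ If $G$ has $n$ vertices and $m$ edges, write $\mathcal{S}(G)^{(k)}=\mathcal{S}_{n,m}^{(k)}$. **Theorem.** Let $c$ be a positive integer, $d$ a nonnegative integer, and $G_0$ a graph all of whose vertices have degree $d-1$ or $d$. For nonnegative integers $p,q$ let $G_0(p,q)=G_0\cup pK_{d+1}\cup qK_d$ be the disjoint union of $G_0$, $p$ copies of $K_{d+1}$ and $q$ copies of $K_d$. Assume that $G_0(p,q)\in\mathcal{S}(G_0(p,q))^{(c+1)}$ for all nonnegative integers $p$ and $q$. Then for all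 nonnegative integers $p,q$ and every graph $H$ with the same number of vertices and the same number of edges as $G_0(p,q)$ such that $H\notin\mathcal{S}(G_0(p,q))^{(c+1)}$ and $n(H)\ge 2d+n(G_0)(2d)^{c+2}$, $$t(\overline{H})<t(\overline{G_0(p,q)}).$$ -/

import Mathlib

/-- `t(G)`: the number of spanning trees of `G`, i.e. of subgraphs of `G` on the whole vertex
set that are trees. -/
noncomputable def spanningTreeCount {V : Type*} (G : SimpleGraph V) : ℕ :=
  {T : SimpleGraph V | T ≤ G ∧ T.IsTree}.ncard

open Classical in
/-- `ℓ_k(G)`: the trace of the `k`-th power of the Laplacian matrix of `G`. -/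
noncomputable def laplacianTrace {V : Type*} [Fintype V] (G : SimpleGraph V) (k : ℕ) : ℝ :=
  ((G.lapMatrix ℝ) ^ k).trace

/-- The class `S_{n,m}^{(k)}`, `k ≥ 1`, realised on a fixed vertex set `V` with `n` elements:
`S^{(1)}` consists of all simple graphs with `m` edges, and `S^{(k+1)}` of the members of
`S^{(k)}` that minimize `ℓ_{k+1}` over `S^{(k)}`. The index `0` is not used. -/
def lexMinClass (V : Type*) [Fintype V] (m : ℕ) : ℕ → Set (SimpleGraph V)
  | 0 => {G | G.edgeSet.ncard = m}
  | 1 => {G | G.edgeSet.ncard = m}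
  | k + 2 => {G | G ∈ lexMinClass V m (k + 1) ∧
      ∀ H ∈ lexMinClass V m (k + 1), laplacianTrace G (k + 2) ≤ laplacianTrace H (k + 2)}

/-- The disjoint union of `p` copies of `G`. -/
def disjointCopies {V : Type*} (p : ℕ) (G : SimpleGraph V) : SimpleGraph (Fin p × V) where
  Adj x y := x.1 = y.1 ∧ G.Adj x.2 y.2
  symm := ⟨fun _ _ h => ⟨h.1.symm, h.2.symm⟩⟩
  loopless := ⟨fun _ h => G.irrefl h.2⟩

/-- `G₀(p,q)`: the disjoint union of `G₀`, `p` copies of `K_{d+1}` and `q` copies of `K_d`. -/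
def extendByCliques {V : Type*} (G₀ : SimpleGraph V) (d p q : ℕ) :
    SimpleGraph (V ⊕ ((Fin p × Fin (d + 1)) ⊕ (Fin q × Fin d))) :=
  SimpleGraph.sum G₀
    (SimpleGraph.sum (disjointCopies p (⊤ : SimpleGraph (Fin (d + 1))))
      (disjointCopies q (⊤ : SimpleGraph (Fin d))))

/-! Write `n` for the number of vertices. By the matrix tree theorem, `n² t(Gᶜ) = det(nI - L(G)) = ∏
(n - λ_i)` over all Laplacian eigenvalues of `G` (`card_sq_mul_spanningTreeCount_compl_eq_prod`).
Taking logarithms, `log ∏ (1 - λ_i/n) = -∑_j ℓ_j(G) / (j n^j)`, so for large `n` the graph whose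
traces are lexicographically smaller has more spanning trees in its complement.

If `H` lies outside the minimizing class, its traces agree with those of `G = G₀(p,q)` up to some
exponent `k ≤ c`, and at `k + 1` that of `H` is larger, hence larger by at least 1 because traces
are integers. What must be excluded is that later terms undo this gain, uniformly in `p` and `q`.
For this, `ℓ_{k+1}(H) ≥ ∑ deg (deg + 1)^k` by a Jensen argument, with equality for disjoint unions
of cliques; as `x (x + 1)^k` is convex, its chord through `d - 1` and `d` bounds the sum below using
only the numbers of vertices and edges. The cliques of `G` attain this bound, so `ℓ_j(G)` exceeds
`ℓ_j(H)` by at most the contribution of `G₀`, which is at most `n(G₀) (2d)^j`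
(`laplacianTrace_extendByCliques_le`). The tail is then dominated by a geometric series, and the
lower bound on `n` makes it smaller than the gain (`prod_sub_lt_prod_sub`). -/

/-! ### Spanning trees encoded as parent maps towards a root -/

section ParentMaps

variable {V : Type*}

/-- `f` assigns to every vertex other than the root `r` a neighbour in `K`, fixes `r`, and its
iterates lead every vertex to `r`. -/
structure IsParentMap (K : SimpleGraph V) (r : V) (f : V → V) : Prop where
  root : f r = r
  adj : ∀ i, i ≠ r → K.Adj i (f i)
  reaches : ∀ i, ∃ k, f^[k] i = r

/-- The graph joining every vertex to its image under `f`. -/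
def parentGraph (f : V → V) : SimpleGraph V := SimpleGraph.fromRel fun i j => f i = j

lemma parentGraph_adj {f : V → V} {i j : V} :
    (parentGraph f).Adj i j ↔ i ≠ j ∧ (f i = j ∨ f j = i) := by
  simp [parentGraph]

lemma IsParentMap.no_two_cycle {K : SimpleGraph V} {r : V} {f : V → V} (hf : IsParentMap K r f)
    {i : V} (hi : i ≠ r) : f (f i) ≠ i := by
  intro h
  have hne : f i ≠ r := fun h' => hi (by rw [← h, h', hf.root])
  have key : ∀ k, f^[k] i = i ∨ f^[k] i = f i := by
    intro k
    induction k with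
    | zero => simp
    | succ k ih =>
      rw [Function.iterate_succ_apply']
      rcases ih with ih | ih <;> rw [ih]
      · exact Or.inr rfl
      · exact Or.inl h
  obtain ⟨k, hk⟩ := hf.reaches i
  rcases key k with h' | h'
  · exact hi (h' ▸ hk)
  · exact hne (h' ▸ hk)

lemma IsParentMap.parentGraph_le {K : SimpleGraph V} {r : V} {f : V → V}
    (hf : IsParentMap K r f) : parentGraph f ≤ K := by
  have key : ∀ i j, i ≠ j → f i = j → K.Adj i j := by
    rintro i j hne rfl
    refine hf.adj i fun h => hne ?_
    rw [h, hf.root]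
  intro i j h
  obtain ⟨hne, h | h⟩ := parentGraph_adj.1 h
  · exact key i j hne h
  · exact (key j i hne.symm h).symm

lemma IsParentMap.to_parentGraph {K : SimpleGraph V} {r : V} {f : V → V}
    (hf : IsParentMap K r f) : IsParentMap (parentGraph f) r f :=
  ⟨hf.root, fun i hi => parentGraph_adj.2 ⟨(hf.adj i hi).ne, Or.inl rfl⟩, hf.reaches⟩

lemma IsParentMap.connected {K : SimpleGraph V} {r : V} {f : V → V}
    (hf : IsParentMap K r f) : K.Connected := by
  have key : ∀ k i, f^[k] i = r → K.Reachable i r := by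
    intro k
    induction k with
    | zero => rintro i rfl; exact SimpleGraph.Reachable.refl _
    | succ k ih =>
      intro i hi
      by_cases hir : i = r
      · rw [hir]
      · exact (hf.adj i hir).reachable.trans (ih _ hi)
  have : Nonempty V := ⟨r⟩
  refine ⟨fun i j => ?_⟩
  obtain ⟨k, hk⟩ := hf.reaches i
  obtain ⟨l, hl⟩ := hf.reaches j
  exact (key k i hk).trans (key l j hl).symm

lemma IsParentMap.injOn_edge {K : SimpleGraph V} {r : V} {f : V → V}
    (hf : IsParentMap K r f) : Set.InjOn (fun i => s(i, f i)) {i | i ≠ r} := by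
  intro i hi j hj h
  rcases Sym2.eq_iff.1 h with h | h
  · exact h.1
  · exact absurd (by rw [h.2, ← h.1] : f (f i) = i) (hf.no_two_cycle hi)

lemma exists_isParentMap {T : SimpleGraph V} (hT : T.Connected) (r : V) :
    ∃ f, IsParentMap T r f := by
  have step : ∀ i, ∃ j, (i = r → j = r) ∧ (i ≠ r → T.Adj i j ∧ T.dist j r < T.dist i r) := by
    intro i
    by_cases hir : i = r
    · exact ⟨r, fun _ => rfl, fun h => absurd hir h⟩
    · obtain ⟨w, hw⟩ := hT.exists_walk_length_eq_dist i r
      cases w with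
      | nil => exact absurd rfl hir
      | @cons _ j _ h w =>
        refine ⟨j, fun h => absurd h hir, fun _ => ⟨h, ?_⟩⟩
        have := SimpleGraph.dist_le w
        rw [SimpleGraph.Walk.length_cons] at hw
        omega
  choose f hroot hf using step
  refine ⟨f, hroot r rfl, fun i hi => (hf i hi).1, ?_⟩
  have key : ∀ m i, T.dist i r < m → ∃ k, f^[k] i = r := by
    intro m
    induction m with
    | zero => intro i hi; omega
    | succ m ih =>
      intro i hi
      by_cases hir : i = r
      · exact ⟨0, hir⟩
      · obtain ⟨k, hk⟩ := ih (f i) (lt_of_lt_of_le (hf i hir).2 (by omega))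
        exact ⟨k + 1, hk⟩
  exact fun i => key _ i (Nat.lt_succ_self _)

variable [Fintype V]

lemma ncard_ne_add_one (r : V) : {i : V | i ≠ r}.ncard + 1 = Nat.card V := by
  have h := Set.ncard_add_ncard_compl ({r} : Set V)
  rw [Set.ncard_singleton] at h
  rw [← h, add_comm]
  rfl

/-- The graph is connected, and each edge comes from a non-root vertex, so there are at most `n - 1`
edges. -/
lemma IsParentMap.isTree_parentGraph {K : SimpleGraph V} {r : V} {f : V → V}
    (hf : IsParentMap K r f) : (parentGraph f).IsTree := by
  have hc := hf.to_parentGraph.connected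
  rw [SimpleGraph.isTree_iff_connected_and_card]
  refine ⟨hc, le_antisymm ?_ hc.card_vert_le_card_edgeSet_add_one⟩
  have hsub : (parentGraph f).edgeSet ⊆ (fun i => s(i, f i)) '' {i | i ≠ r} := by
    have key : ∀ i j, i ≠ j → f i = j → s(i, j) ∈ (fun i => s(i, f i)) '' {i | i ≠ r} := by
      rintro i j hne rfl
      exact ⟨i, fun h => hne (by rw [h, hf.root]), rfl⟩
    intro e
    induction e with
    | _ i j =>
      intro h
      obtain ⟨hne, h | h⟩ := parentGraph_adj.1 h
      · exact key i j hne h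
      · rw [Sym2.eq_swap]
        exact key j i hne.symm h
  rw [← ncard_ne_add_one r, ← hf.injOn_edge.ncard_image, Nat.card_coe_set_eq]
  exact Nat.add_le_add_right (Set.ncard_le_ncard hsub (Set.toFinite _)) 1

lemma IsParentMap.eq_of_isTree {T : SimpleGraph V} (hT : T.IsTree) {r : V} {f g : V → V}
    (hf : IsParentMap T r f) (hg : IsParentMap T r g) : f = g := by
  -- The `n - 1` parent edges of `f` are distinct, so they exhaust the tree; every edge `s(i, g i)`
  -- is therefore also a parent edge of `f`.
  have himage : (fun i => s(i, f i)) '' {i | i ≠ r} = T.edgeSet := by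
    refine Set.eq_of_subset_of_ncard_le ?_ ?_ (Set.toFinite _)
    · rintro _ ⟨i, hi, rfl⟩
      exact hf.adj i hi
    · have h := (SimpleGraph.isTree_iff_connected_and_card.1 hT).2
      rw [Nat.card_coe_set_eq, ← ncard_ne_add_one r] at h
      rw [hf.injOn_edge.ncard_image]
      omega
  have key : ∀ k i, g^[k] i = r → f i = g i := by
    intro k
    induction k with
    | zero => rintro i rfl; exact hf.root.trans hg.root.symm
    | succ k ih =>
      intro i hi
      by_cases hir : i = r
      · rw [hir, hf.root, hg.root]
      have hmem : s(i, g i) ∈ T.edgeSet := hg.adj i hir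
      rw [← himage] at hmem
      obtain ⟨j, hj, h⟩ := hmem
      rcases Sym2.eq_iff.1 h with ⟨h1, h2⟩ | ⟨h1, h2⟩
      · rw [← h1, h2, h1]
      -- Here `f` sends `g i` back to `i`; since `f` and `g` agree at `g i` by induction, `g` would
      -- have a 2-cycle.
      · refine absurd ?_ (hg.no_two_cycle hir)
        rw [← ih (g i) hi, ← h1, h2]
  funext i
  obtain ⟨k, hk⟩ := hg.reaches i
  exact key k i hk

lemma spanningTreeCount_eq_ncard_isParentMap (K : SimpleGraph V) (r : V) :
    spanningTreeCount K = {f | IsParentMap K r f}.ncard := by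
  have himage : {T : SimpleGraph V | T ≤ K ∧ T.IsTree} = parentGraph '' {f | IsParentMap K r f} := by
    ext T
    constructor
    · rintro ⟨hle, hT⟩
      obtain ⟨f, hf⟩ := exists_isParentMap hT.1 r
      refine ⟨f, ⟨hf.root, fun i hi => hle (hf.adj i hi), hf.reaches⟩, ?_⟩
      exact le_antisymm hf.parentGraph_le
        ((SimpleGraph.isTree_iff_minimal_connected.1 hT).2 hf.to_parentGraph.connected
          hf.parentGraph_le)
    · rintro ⟨f, hf, rfl⟩
      exact ⟨hf.parentGraph_le, hf.isTree_parentGraph⟩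
  refine Eq.trans (congrArg Set.ncard himage) (Set.InjOn.ncard_image ?_)
  intro f hf g hg h
  have hg' := hg.to_parentGraph
  rw [← h] at hg'
  exact hf.to_parentGraph.eq_of_isTree hf.isTree_parentGraph hg'

end ParentMaps

/-! ### The matrix tree theorem and the complement formula -/

section MatrixTree

variable {V : Type*} [Fintype V] [DecidableEq V]

/-- The identity matrix minus the adjacency matrix of the functional digraph of `f`, the loop at
`r` being left out. -/
def parentMatrix (r : V) (f : V → V) : Matrix V V ℝ :=
  fun i j => (if i = j then 1 else 0) - if i ≠ r ∧ f i = j then 1 else 0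

lemma det_parentMatrix_of_reaches {r : V} {f : V → V} (hr : ∀ i, ∃ k, f^[k] i = r) :
    (parentMatrix r f).det = 1 := by
  classical
  -- Ordering vertices by the number of steps to the root makes the matrix triangular with unit
  -- diagonal.
  let b : V → ℕ := fun i => Nat.find (hr i)
  have hb : ∀ i, i ≠ r → b (f i) < b i := by
    intro i hi
    have h := Nat.find_spec (hr i)
    obtain ⟨m, hm⟩ : ∃ m, Nat.find (hr i) = m + 1 := by
      refine Nat.exists_eq_succ_of_ne_zero fun h0 => hi ?_
      rw [h0] at h
      exact h
    rw [hm] at h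
    have : b (f i) ≤ m := Nat.find_min' _ h
    change b (f i) < Nat.find (hr i)
    omega
  have hM : (parentMatrix r f).BlockTriangular (fun i => OrderDual.toDual (b i)) := by
    intro i j hij
    have hij' : b i < b j := hij
    have h1 : i ≠ j := fun h => by rw [h] at hij'; exact lt_irrefl _ hij'
    have h2 : ¬ (i ≠ r ∧ f i = j) := by
      rintro ⟨h, rfl⟩
      exact absurd (hb i h) (by omega)
    simp [parentMatrix, h1, h2]
  rw [hM.det]
  refine Finset.prod_eq_one fun a _ => ?_
  have : (parentMatrix r f).toSquareBlock (fun i => OrderDual.toDual (b i)) a = 1 := by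
    ext ⟨i, hi⟩ ⟨j, hj⟩
    have h2 : ¬ (i ≠ r ∧ f i = j) := by
      rintro ⟨h, rfl⟩
      have := hb i h
      rw [← hj] at hi
      have hi' : b i = b (f i) := hi
      omega
    simp only [Matrix.toSquareBlock_def, parentMatrix, Matrix.of_apply, Matrix.one_apply,
      Subtype.mk.injEq, h2, if_false, sub_zero]
  rw [this, Matrix.det_one]

open Matrix in
lemma det_parentMatrix_of_not_reaches {r : V} {f : V → V} (hr : ¬ ∀ i, ∃ k, f^[k] i = r) :
    (parentMatrix r f).det = 0 := by
  classical
  push Not at hr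
  obtain ⟨i₀, hi₀⟩ := hr
  -- The indicator of the vertices that never reach `r` is a nonzero kernel vector.
  refine Matrix.exists_mulVec_eq_zero_iff.1
    ⟨fun i => if ∀ k, f^[k] i ≠ r then 1 else 0, fun h => ?_, ?_⟩
  · have := congrFun h i₀
    simp [hi₀] at this
  · funext i
    have hexp : (parentMatrix r f *ᵥ fun i => if ∀ k, f^[k] i ≠ r then (1 : ℝ) else 0) i =
        (if ∀ k, f^[k] i ≠ r then 1 else 0) -
          if i ≠ r then (if ∀ k, f^[k] (f i) ≠ r then 1 else 0) else 0 := by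
      simp only [Matrix.mulVec, dotProduct, parentMatrix, sub_mul, Finset.sum_sub_distrib, ite_mul,
        one_mul, zero_mul, Finset.sum_ite_eq, Finset.mem_univ, if_true]
      by_cases hir : i = r <;> simp [hir]
    rw [hexp, Pi.zero_apply]
    by_cases hir : i = r
    · have : ¬ ∀ k, f^[k] i ≠ r := fun h => h 0 hir
      simp [hir] at this ⊢
      exact this
    · have : (∀ k, f^[k] i ≠ r) ↔ ∀ k, f^[k] (f i) ≠ r := by
        constructor
        · exact fun h k => h (k + 1)
        · rintro h (_ | k)
          · exact hir
          · exact h k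
      simp [hir, this]

/-- The **matrix tree theorem**, with the row of the root replaced by a unit vector. -/
theorem det_updateRow_lapMatrix (K : SimpleGraph V) [DecidableRel K.Adj] (r : V) :
    ((K.lapMatrix ℝ).updateRow r (Pi.single r 1)).det = spanningTreeCount K := by
  classical
  -- Row `i` of the Laplacian is the sum of `e_i - e_j` over neighbours `j`. Multilinearity expands
  -- the determinant over all choices `f` of one `j` per row; a choice contributes 1 if it is a
  -- parent map and 0 otherwise.
  let g : V → V → V → ℝ := fun i j =>
    if i = r then (if j = r then Pi.single r 1 else 0)
    else if K.Adj i j then Pi.single i 1 - Pi.single j 1 else 0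
  have hrows : (K.lapMatrix ℝ).updateRow r (Pi.single r 1) = fun i => ∑ j, g i j := by
    ext i k
    rw [Finset.sum_apply]
    by_cases hir : i = r
    · subst hir
      simp [g, Matrix.updateRow_self, ite_apply]
    · rw [Matrix.updateRow_ne hir]
      simp only [g, hir, if_false, ite_apply, SimpleGraph.lapMatrix, SimpleGraph.degMatrix,
        Matrix.sub_apply, Matrix.diagonal_apply, SimpleGraph.adjMatrix_apply, Pi.sub_apply,
        Pi.zero_apply, Pi.single_apply]
      have : ∀ j, (if K.Adj i j then ((if k = i then (1 : ℝ) else 0) - if k = j then 1 else 0)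
          else 0) = (if K.Adj i j then (1 : ℝ) else 0) * (if k = i then (1 : ℝ) else 0) -
            (if k = j then (if K.Adj i j then (1 : ℝ) else 0) else 0) := by
        intro j
        split_ifs <;> simp
      simp only [this, Finset.sum_sub_distrib, ← Finset.sum_mul, ← SimpleGraph.degree_eq_sum_if_adj,
        Finset.sum_ite_eq, Finset.mem_univ, if_true]
      by_cases hik : i = k
      · simp [hik]
      · simp [hik, Ne.symm hik]
  have hdet : ∀ f : V → V, Matrix.det (fun i => g i (f i)) =
      if IsParentMap K r f then 1 else 0 := by
    intro f
    by_cases hroot : f r = r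
    · by_cases hadj : ∀ i, i ≠ r → K.Adj i (f i)
      · have : (fun i => g i (f i)) = parentMatrix r f := by
          funext i k
          by_cases hir : i = r
          · subst hir
            simp [g, hroot, parentMatrix, Pi.single_apply, eq_comm]
          · simp only [g, hir, hadj i hir, parentMatrix, Pi.single_apply, Pi.sub_apply, if_true,
              if_false, ne_eq, not_false_eq_true, true_and, eq_comm (a := k)]
        rw [this]
        split_ifs with h
        · exact det_parentMatrix_of_reaches h.reaches
        · exact det_parentMatrix_of_not_reaches fun h' => h ⟨hroot, hadj, h'⟩
      · rw [if_neg fun h => hadj h.adj]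
        push Not at hadj
        obtain ⟨i, hi, hni⟩ := hadj
        refine Matrix.det_eq_zero_of_row_eq_zero i fun k => ?_
        simp [g, hi, hni]
    · rw [if_neg fun h => hroot h.root]
      refine Matrix.det_eq_zero_of_row_eq_zero r fun k => ?_
      simp [g, hroot]
  rw [hrows]
  have := (Matrix.detRowAlternating (n := V) (R := ℝ)).toMultilinearMap.map_sum g
  refine Eq.trans this ?_
  refine Eq.trans (Finset.sum_congr rfl fun f _ => hdet f) ?_
  rw [Finset.sum_boole, spanningTreeCount_eq_ncard_isParentMap K r, ← Set.ncard_coe_finset]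
  simp

open Matrix in
lemma det_one_add_vecMulVec (u v : V → ℝ) : (1 + vecMulVec u v).det = 1 + v ⬝ᵥ u := by
  rw [vecMulVec_eq Unit, det_one_add_replicateCol_mul_replicateRow]

open Matrix in
-- Since `L` kills the all-ones vector on both sides, `L + 11ᵀ` factors through `L + eeᵀ`, where `e`
-- is the unit vector at a root; each of the two outer factors has determinant `n`.
lemma det_lapMatrix_add_vecMulVec_one [Nonempty V] (K : SimpleGraph V) [DecidableRel K.Adj] :
    (K.lapMatrix ℝ + vecMulVec 1 1).det = (Fintype.card V : ℝ) ^ 2 * spanningTreeCount K := by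
  classical
  obtain ⟨r⟩ := ‹Nonempty V›
  set L := K.lapMatrix ℝ with hL
  have hL1 : L *ᵥ 1 = 0 := K.lapMatrix_mulVec_const_eq_zero
  have hL2 : 1 ᵥ* L = 0 := by rw [← mulVec_transpose, (K.isSymm_lapMatrix ℝ).eq, hL1]
  set e : V → ℝ := Pi.single r 1 with he
  have he1 : e ⬝ᵥ 1 = 1 := by simp [he]
  have h1e : (1 : V → ℝ) ⬝ᵥ e = 1 := by simp [he]
  have h11 : (1 : V → ℝ) ⬝ᵥ 1 = Fintype.card V := by simp [dotProduct]
  have hright : L + vecMulVec 1 1 = (L + vecMulVec 1 e) * (1 + vecMulVec 1 (1 - e)) := by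
    rw [add_mul, mul_add, mul_add, mul_one, mul_one, mul_vecMulVec, hL1, vecMulVec_mul_vecMulVec,
      he1, one_smul, zero_vecMulVec, vecMulVec_sub]
    abel
  have hleft : L + vecMulVec 1 e = (1 + vecMulVec (1 - e) 1) * (L + vecMulVec e e) := by
    rw [add_mul, mul_add, mul_add, one_mul, one_mul, vecMulVec_mul, hL2, vecMulVec_mul_vecMulVec,
      h1e, one_smul, vecMulVec_zero, sub_vecMulVec]
    abel
  have hroot : (L + vecMulVec e e).det = spanningTreeCount K := by
    have hrow : L + vecMulVec e e = L.updateRow r (L r + e) := by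
      ext i j
      by_cases hi : i = r
      · subst hi
        simp [vecMulVec_apply, he]
      · simp [vecMulVec_apply, he, hi]
    rw [hrow, det_updateRow_add, updateRow_eq_self, ← det_updateRow_lapMatrix K r,
      SimpleGraph.det_lapMatrix_eq_zero, zero_add]
  rw [hright, det_mul, hleft, det_mul, hroot, det_one_add_vecMulVec, det_one_add_vecMulVec,
    sub_dotProduct, dotProduct_sub, h11, he1, h1e]
  ring

open Matrix in
lemma scalar_card_sub_lapMatrix (G : SimpleGraph V) [DecidableRel G.Adj] :
    scalar V (Fintype.card V : ℝ) - G.lapMatrix ℝ = Gᶜ.lapMatrix ℝ + vecMulVec 1 1 := by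
  ext i j
  by_cases hij : i = j
  · subst hij
    have := G.degree_compl i
    have hlt := G.degree_lt_card_verts i
    simp only [SimpleGraph.lapMatrix, SimpleGraph.degMatrix, Matrix.add_apply, Matrix.sub_apply,
      diagonal_apply_eq, SimpleGraph.adjMatrix_apply, vecMulVec_apply, scalar_apply, this,
      SimpleGraph.irrefl, if_false, Pi.one_apply]
    rw [Nat.sub_sub, Nat.cast_sub (by omega)]
    push_cast
    ring
  · simp only [SimpleGraph.lapMatrix, SimpleGraph.degMatrix, Matrix.add_apply, Matrix.sub_apply,
      diagonal_apply_ne _ hij, SimpleGraph.adjMatrix_apply, vecMulVec_apply, scalar_apply,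
      SimpleGraph.compl_adj, Pi.one_apply]
    by_cases h : G.Adj i j <;> simp [h, hij]

open Matrix in
/-- The number of spanning trees of the complement, in terms of the Laplacian characteristic
polynomial. -/
theorem card_sq_mul_spanningTreeCount_compl [Nonempty V] (G : SimpleGraph V) [DecidableRel G.Adj] :
    (Fintype.card V : ℝ) ^ 2 * spanningTreeCount Gᶜ =
      (G.lapMatrix ℝ).charpoly.eval (Fintype.card V : ℝ) := by
  rw [← det_lapMatrix_add_vecMulVec_one, eval_charpoly, scalar_card_sub_lapMatrix]

end MatrixTree

/-! ### Laplacian eigenvalues and trace bounds -/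

section Spectral

open Matrix

variable {V : Type*} [Fintype V]

lemma Matrix.IsHermitian.pow_apply_self [DecidableEq V] {A : Matrix V V ℝ} (hA : A.IsHermitian)
    (k : ℕ) (v : V) :
    (A ^ k) v v = ∑ i, hA.eigenvalues i ^ k * (hA.eigenvectorUnitary : Matrix V V ℝ) v i ^ 2 := by
  conv_lhs => rw [hA.spectral_theorem, ← map_pow, Unitary.conjStarAlgAut_apply, diagonal_pow]
  rw [Matrix.mul_apply]
  refine Finset.sum_congr rfl fun i _ => ?_
  rw [mul_diagonal, star_apply]
  simp
  ring

lemma Matrix.IsHermitian.trace_pow_eq_sum [DecidableEq V] {A : Matrix V V ℝ} (hA : A.IsHermitian)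
    (k : ℕ) : (A ^ k).trace = ∑ i, hA.eigenvalues i ^ k := by
  conv_lhs => rw [hA.spectral_theorem, ← map_pow, Unitary.conjStarAlgAut_apply, diagonal_pow,
    trace_mul_cycle, Unitary.coe_star_mul_self, one_mul, trace_diagonal]
  simp

lemma Matrix.IsHermitian.eigenvalues_le_of_posSemidef [DecidableEq V] {A : Matrix V V ℝ}
    (hA : A.IsHermitian) {c : ℝ} (h : (scalar V c - A).PosSemidef) (i : V) :
    hA.eigenvalues i ≤ c := by
  set x : V → ℝ := ⇑(hA.eigenvectorBasis i) with hx
  have hAx : A *ᵥ x = hA.eigenvalues i • x := hA.mulVec_eigenvectorBasis i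
  have h1 := h.dotProduct_mulVec_nonneg x
  have hxx : x ⬝ᵥ x = 1 := by
    have := hA.eigenvectorBasis.orthonormal.1 i
    have h2 : ‖hA.eigenvectorBasis i‖ ^ 2 = 1 := by rw [this]; norm_num
    rw [EuclideanSpace.norm_sq_eq] at h2
    rw [← h2, dotProduct]
    refine Finset.sum_congr rfl fun j _ => ?_
    rw [Real.norm_eq_abs, sq_abs, sq]
  have hs : scalar V c *ᵥ x = c • x := by
    ext j
    simp [scalar_apply, mulVec_diagonal]
  rw [star_trivial, sub_mulVec, hAx, hs, dotProduct_sub, dotProduct_smul, dotProduct_smul, hxx] at h1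
  simp only [smul_eq_mul, mul_one] at h1
  linarith

lemma laplacianTrace_eq_trace_pow [DecidableEq V] (G : SimpleGraph V) [DecidableRel G.Adj] (k : ℕ) :
    laplacianTrace G k = ((G.lapMatrix ℝ) ^ k).trace := by
  unfold laplacianTrace
  congr!

open Classical in
/-- The Laplacian eigenvalues of a graph. -/
noncomputable def lapEigenvalues (G : SimpleGraph V) : V → ℝ :=
  (G.isHermitian_lapMatrix ℝ).eigenvalues

lemma laplacianTrace_eq_sum (G : SimpleGraph V) (k : ℕ) :
    laplacianTrace G k = ∑ i, lapEigenvalues G i ^ k := by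
  classical
  rw [lapEigenvalues, ← Matrix.IsHermitian.trace_pow_eq_sum, laplacianTrace]

lemma lapEigenvalues_nonneg (G : SimpleGraph V) (i : V) : 0 ≤ lapEigenvalues G i := by
  classical
  exact (G.posSemidef_lapMatrix ℝ).eigenvalues_nonneg i

lemma lapEigenvalues_le_card (G : SimpleGraph V) (i : V) :
    lapEigenvalues G i ≤ Fintype.card V := by
  classical
  refine Matrix.IsHermitian.eigenvalues_le_of_posSemidef _ ?_ i
  -- `nI - L(G)` is the Laplacian of the complement plus `11ᵀ`, both positive semidefinite.
  rw [scalar_card_sub_lapMatrix]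
  refine (SimpleGraph.posSemidef_lapMatrix ℝ _).add ?_
  simpa using posSemidef_vecMulVec_self_star (1 : V → ℝ)

lemma card_sq_mul_spanningTreeCount_compl_eq_prod [Nonempty V] (G : SimpleGraph V) :
    (Fintype.card V : ℝ) ^ 2 * spanningTreeCount Gᶜ =
      ∏ i, ((Fintype.card V : ℝ) - lapEigenvalues G i) := by
  classical
  rw [card_sq_mul_spanningTreeCount_compl, (G.isHermitian_lapMatrix ℝ).charpoly_eq,
    Polynomial.eval_prod]
  simp [lapEigenvalues]

lemma lapMatrix_apply_self [DecidableEq V] (R : Type*) [AddGroupWithOne R] (G : SimpleGraph V)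
    [DecidableRel G.Adj] (v : V) : G.lapMatrix R v v = G.degree v := by
  simp [SimpleGraph.lapMatrix, SimpleGraph.degMatrix]

lemma lapMatrix_sq_apply_self [DecidableEq V] (G : SimpleGraph V) [DecidableRel G.Adj] (v : V) :
    (G.lapMatrix ℝ ^ 2) v v = (G.degree v : ℝ) ^ 2 + G.degree v := by
  have h : ∀ j, G.lapMatrix ℝ v j * G.lapMatrix ℝ j v =
      (if v = j then (G.degree v : ℝ) ^ 2 else 0) + if G.Adj v j then 1 else 0 := by
    intro j
    by_cases hj : v = j
    · subst hj
      simp [lapMatrix_apply_self, sq]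
    · by_cases h : G.Adj v j <;>
        simp [SimpleGraph.lapMatrix, SimpleGraph.degMatrix, hj, Ne.symm hj, h, G.adj_comm j v]
  rw [sq, Matrix.mul_apply, Finset.sum_congr rfl fun j _ => h j, Finset.sum_add_distrib,
    ← SimpleGraph.degree_eq_sum_if_adj]
  simp

lemma lapEigenvalues_le_two_mul (G : SimpleGraph V) [DecidableRel G.Adj] {d : ℕ}
    (hd : ∀ v, G.degree v ≤ d) (i : V) : lapEigenvalues G i ≤ 2 * d := by
  classical
  have hev : Module.End.HasEigenvalue (Matrix.toLin' (G.lapMatrix ℝ)) (lapEigenvalues G i) := by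
    have h := (G.isHermitian_lapMatrix ℝ).mulVec_eigenvectorBasis i
    refine Module.End.hasEigenvalue_of_hasEigenvector
      (x := ⇑((G.isHermitian_lapMatrix ℝ).eigenvectorBasis i)) ⟨?_, ?_⟩
    · rw [Module.End.mem_eigenspace_iff, Matrix.toLin'_apply, h, lapEigenvalues]
      congr!
    · intro h0
      refine (G.isHermitian_lapMatrix ℝ).eigenvectorBasis.orthonormal.ne_zero i ?_
      ext j
      exact congrFun h0 j
  -- Gershgorin: the disc of row `v` has centre and radius both equal to the degree of `v`.
  obtain ⟨v, hv⟩ := eigenvalue_mem_ball hev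
  have hsum : ∑ j ∈ Finset.univ.erase v, ‖G.lapMatrix ℝ v j‖ = G.degree v := by
    rw [SimpleGraph.degree_eq_sum_if_adj, ← Finset.sum_erase Finset.univ (a := v) (by simp)]
    refine Finset.sum_congr rfl fun j hj => ?_
    have hne : v ≠ j := (Finset.ne_of_mem_erase hj).symm
    by_cases h : G.Adj v j <;> simp [SimpleGraph.lapMatrix, SimpleGraph.degMatrix, hne, h]
  rw [hsum, lapMatrix_apply_self, Metric.mem_closedBall, Real.dist_eq] at hv
  have h1 := (abs_le.1 hv).2
  have h2 : (G.degree v : ℝ) ≤ d := by exact_mod_cast hd v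
  linarith

/-- Jensen for the spectral measure at `v`: its first two moments are `deg` and `deg² + deg`, so
after weighting by `x` it has mass `deg` and mean `deg + 1`, and `x ↦ x^k` is convex. -/
lemma degree_mul_pow_le_lapMatrix_pow_apply_self [DecidableEq V] (G : SimpleGraph V)
    [DecidableRel G.Adj] (k : ℕ) (v : V) :
    (G.degree v : ℝ) * ((G.degree v : ℝ) + 1) ^ k ≤ (G.lapMatrix ℝ ^ (k + 1)) v v := by
  have hA := G.isHermitian_lapMatrix ℝ
  set a : ℝ := (G.degree v : ℝ) + 1 with ha
  have ha0 : 0 < a := by positivity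
  -- The tangent line of `x^k` at `a = deg + 1`, from Bernoulli's inequality, multiplied by `x`. For
  -- `k = 0` the truncated exponent `k - 1` is harmless, its coefficient being 0.
  have hpoint : ∀ x : ℝ, 0 ≤ x → x * a ^ k + k * a ^ (k - 1) * (x ^ 2 - a * x) ≤ x ^ (k + 1) := by
    intro x hx
    have hb := one_add_mul_le_pow (a := x / a - 1) (by have := div_nonneg hx ha0.le; linarith) k
    have h1 : (1 + (x / a - 1)) ^ k = x ^ k / a ^ k := by rw [add_sub_cancel, div_pow]
    rw [h1, le_div_iff₀ (by positivity)] at hb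
    rcases k with _ | k
    · simp
    · have h2 : (1 + ((k + 1 : ℕ) : ℝ) * (x / a - 1)) * a ^ (k + 1) =
          a ^ (k + 1) + ((k + 1 : ℕ) : ℝ) * a ^ k * (x - a) := by
        field_simp
        ring
      rw [h2] at hb
      have h3 := mul_le_mul_of_nonneg_left hb hx
      simp only [Nat.add_sub_cancel]
      calc _ = x * (a ^ (k + 1) + ((k + 1 : ℕ) : ℝ) * a ^ k * (x - a)) := by ring
        _ ≤ _ := h3
        _ = _ := by ring
  have hsum := Finset.sum_le_sum fun i (_ : i ∈ Finset.univ) =>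
    mul_le_mul_of_nonneg_right (hpoint _ ((G.posSemidef_lapMatrix ℝ).eigenvalues_nonneg i))
      (sq_nonneg ((hA.eigenvectorUnitary : Matrix V V ℝ) v i))
  have hone := hA.pow_apply_self 1 v
  have htwo := hA.pow_apply_self 2 v
  rw [pow_one, lapMatrix_apply_self] at hone
  rw [lapMatrix_sq_apply_self] at htwo
  rw [← hA.pow_apply_self (k + 1) v] at hsum
  refine le_trans (le_of_eq ?_) hsum
  have hexp : ∀ i, (hA.eigenvalues i * a ^ k + k * a ^ (k - 1) *
      (hA.eigenvalues i ^ 2 - a * hA.eigenvalues i)) *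
        (hA.eigenvectorUnitary : Matrix V V ℝ) v i ^ 2 =
      (a ^ k - k * a ^ (k - 1) * a) *
        (hA.eigenvalues i ^ 1 * (hA.eigenvectorUnitary : Matrix V V ℝ) v i ^ 2) +
      k * a ^ (k - 1) *
        (hA.eigenvalues i ^ 2 * (hA.eigenvectorUnitary : Matrix V V ℝ) v i ^ 2) := by
    intro i; ring
  rw [Finset.sum_congr rfl fun i _ => hexp i, Finset.sum_add_distrib, ← Finset.mul_sum,
    ← Finset.mul_sum, ← hone, ← htwo, ha]
  ring

lemma sum_degree_mul_pow_le_laplacianTrace (G : SimpleGraph V) [DecidableRel G.Adj] (k : ℕ) :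
    ∑ v, (G.degree v : ℝ) * ((G.degree v : ℝ) + 1) ^ k ≤ laplacianTrace G (k + 1) := by
  classical
  rw [laplacianTrace_eq_trace_pow]
  exact Finset.sum_le_sum fun v _ => degree_mul_pow_le_lapMatrix_pow_apply_self G k v

lemma laplacianTrace_one (G : SimpleGraph V) [DecidableRel G.Adj] :
    laplacianTrace G 1 = ∑ v, (G.degree v : ℝ) := by
  classical
  rw [laplacianTrace_eq_trace_pow, pow_one]
  exact Finset.sum_congr rfl fun v _ => lapMatrix_apply_self ℝ G v

lemma sum_degree_eq_two_mul_ncard (G : SimpleGraph V) [DecidableRel G.Adj] :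
    ∑ v, (G.degree v : ℝ) = 2 * G.edgeSet.ncard := by
  classical
  rw [← Nat.cast_sum, G.sum_degrees_eq_twice_card_edges, ← SimpleGraph.coe_edgeFinset,
    Set.ncard_coe_finset]
  push_cast
  rfl

/-- Integrality turns a strict inequality between traces into a gap of at least 1. -/
lemma exists_int_laplacianTrace (G : SimpleGraph V) (k : ℕ) :
    ∃ z : ℤ, laplacianTrace G k = z := by
  classical
  refine ⟨((G.lapMatrix ℤ) ^ k).trace, ?_⟩
  have h : G.lapMatrix ℝ = (G.lapMatrix ℤ).map (Int.castRingHom ℝ) := by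
    ext i j
    simp [SimpleGraph.lapMatrix, SimpleGraph.degMatrix, Matrix.diagonal_apply,
      SimpleGraph.adjMatrix_apply]
  have h2 : (G.lapMatrix ℝ) ^ k = ((G.lapMatrix ℤ) ^ k).map (Int.castRingHom ℝ) := by
    rw [h, Matrix.map_pow]
  rw [laplacianTrace_eq_trace_pow, h2, Matrix.trace, Matrix.trace]
  simp

lemma laplacianTrace_add_one_le {W : Type*} [Fintype W] {G : SimpleGraph V} {H : SimpleGraph W}
    {k : ℕ} (h : laplacianTrace G k < laplacianTrace H k) :
    laplacianTrace G k + 1 ≤ laplacianTrace H k := by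
  obtain ⟨a, ha⟩ := exists_int_laplacianTrace G k
  obtain ⟨b, hb⟩ := exists_int_laplacianTrace H k
  rw [ha, hb] at h ⊢
  exact_mod_cast h

end Spectral

/-! ### Traces of disjoint unions and cliques; the lexicographic classes -/

section LaplacianTraces

open Matrix

variable {V W : Type*} [Fintype V] [Fintype W]

open scoped Kronecker in
lemma laplacianTrace_disjointCopies (p : ℕ) (G : SimpleGraph V) (k : ℕ) :
    laplacianTrace (disjointCopies p G) k = p * laplacianTrace G k := by
  classical
  have hL : (disjointCopies p G).lapMatrix ℝ = (1 : Matrix (Fin p) (Fin p) ℝ) ⊗ₖ G.lapMatrix ℝ := by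
    have hdeg : ∀ i v, (((disjointCopies p G).degree (i, v) : ℕ) : ℝ) = G.degree v := by
      intro i v
      rw [SimpleGraph.degree_eq_sum_if_adj, SimpleGraph.degree_eq_sum_if_adj,
        Fintype.sum_prod_type, Finset.sum_eq_single i]
      · simp [disjointCopies]
      · intro j _ hj
        simp [disjointCopies, hj.symm]
      · simp
    have hadj : ∀ i j v w, (disjointCopies p G).Adj (i, v) (j, w) ↔ i = j ∧ G.Adj v w :=
      fun _ _ _ _ => Iff.rfl
    ext ⟨i, v⟩ ⟨j, w⟩
    rw [kroneckerMap_apply]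
    by_cases hij : i = j
    · subst hij
      by_cases hvw : v = w
      · subst hvw
        simp [lapMatrix_apply_self, hdeg]
      · simp [SimpleGraph.lapMatrix, SimpleGraph.degMatrix, hvw, SimpleGraph.adjMatrix_apply, hadj]
    · simp [SimpleGraph.lapMatrix, SimpleGraph.degMatrix, hij, SimpleGraph.adjMatrix_apply, hadj]
  have hpow : (disjointCopies p G).lapMatrix ℝ ^ k =
      (1 : Matrix (Fin p) (Fin p) ℝ) ⊗ₖ (G.lapMatrix ℝ ^ k) := by
    induction k with
    | zero => rw [pow_zero, pow_zero, one_kronecker_one]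
    | succ k ih => rw [pow_succ, ih, hL, ← mul_kronecker_mul, one_mul, pow_succ]
  rw [laplacianTrace_eq_trace_pow, hpow, trace_kronecker, trace_one, Fintype.card_fin,
    laplacianTrace_eq_trace_pow]

lemma lapMatrix_sum [DecidableEq V] [DecidableEq W] (G : SimpleGraph V) (H : SimpleGraph W)
    [DecidableRel G.Adj] [DecidableRel H.Adj] [DecidableRel (SimpleGraph.sum G H).Adj] :
    (SimpleGraph.sum G H).lapMatrix ℝ = fromBlocks (G.lapMatrix ℝ) 0 0 (H.lapMatrix ℝ) := by
  have hl : ∀ v, (SimpleGraph.sum G H).lapMatrix ℝ (Sum.inl v) (Sum.inl v) =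
      G.lapMatrix ℝ v v := by
    intro v
    rw [lapMatrix_apply_self, lapMatrix_apply_self, SimpleGraph.degree_eq_sum_if_adj,
      SimpleGraph.degree_eq_sum_if_adj, Fintype.sum_sum_type]
    simp
  have hr : ∀ v, (SimpleGraph.sum G H).lapMatrix ℝ (Sum.inr v) (Sum.inr v) =
      H.lapMatrix ℝ v v := by
    intro v
    rw [lapMatrix_apply_self, lapMatrix_apply_self, SimpleGraph.degree_eq_sum_if_adj,
      SimpleGraph.degree_eq_sum_if_adj, Fintype.sum_sum_type]
    simp
  ext (i | i) (j | j)
  · by_cases hij : i = j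
    · subst hij
      rw [hl, fromBlocks_apply₁₁]
    · simp [SimpleGraph.lapMatrix, SimpleGraph.degMatrix, hij]
  · simp [SimpleGraph.lapMatrix, SimpleGraph.degMatrix]
  · simp [SimpleGraph.lapMatrix, SimpleGraph.degMatrix]
  · by_cases hij : i = j
    · subst hij
      rw [hr, fromBlocks_apply₂₂]
    · simp [SimpleGraph.lapMatrix, SimpleGraph.degMatrix, hij]

lemma laplacianTrace_sum (G : SimpleGraph V) (H : SimpleGraph W) (k : ℕ) :
    laplacianTrace (SimpleGraph.sum G H) k = laplacianTrace G k + laplacianTrace H k := by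
  classical
  rw [laplacianTrace_eq_trace_pow, lapMatrix_sum, fromBlocks_diagonal_pow, laplacianTrace_eq_trace_pow,
    laplacianTrace_eq_trace_pow]
  simp [trace, Fintype.sum_sum_type]

lemma lapMatrix_bot [DecidableEq V] [DecidableRel (⊥ : SimpleGraph V).Adj] :
    (⊥ : SimpleGraph V).lapMatrix ℝ = 0 := by
  ext i j
  by_cases hij : i = j
  · subst hij
    simp [lapMatrix_apply_self]
  · simp [SimpleGraph.lapMatrix, SimpleGraph.degMatrix]

lemma laplacianTrace_top_succ (k : ℕ) :
    laplacianTrace (⊤ : SimpleGraph V) (k + 1) =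
      (Fintype.card V : ℝ) ^ k * laplacianTrace (⊤ : SimpleGraph V) 1 := by
  classical
  set L := (⊤ : SimpleGraph V).lapMatrix ℝ with hL
  -- For a complete graph `L = nI - 11ᵀ`, and `L` annihilates `11ᵀ`.
  have hsq : L * L = (Fintype.card V : ℝ) • L := by
    have h := scalar_card_sub_lapMatrix (⊤ : SimpleGraph V)
    have h0 : (⊤ : SimpleGraph V)ᶜ.lapMatrix ℝ = 0 := by
      rw [← lapMatrix_bot]
      congr!
      exact compl_top
    rw [h0, zero_add, sub_eq_iff_eq_add, add_comm, ← sub_eq_iff_eq_add] at h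
    have h1 : L *ᵥ 1 = 0 := (⊤ : SimpleGraph V).lapMatrix_mulVec_const_eq_zero
    nth_rewrite 2 [hL]
    rw [← h, mul_sub, mul_vecMulVec, h1, zero_vecMulVec, sub_zero, scalar_apply,
      ← smul_one_eq_diagonal, mul_smul_comm, mul_one]
  have hpow : L ^ (k + 1) = (Fintype.card V : ℝ) ^ k • L := by
    induction k with
    | zero => simp
    | succ k ih => rw [pow_succ, ih, smul_mul_assoc, hsq, smul_smul, pow_succ]
  rw [laplacianTrace_eq_trace_pow, hpow, trace_smul, laplacianTrace_eq_trace_pow, pow_one,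
    smul_eq_mul]

lemma laplacianTrace_top_one :
    laplacianTrace (⊤ : SimpleGraph V) 1 = Fintype.card V * ((Fintype.card V : ℝ) - 1) := by
  classical
  rw [laplacianTrace_one]
  rcases isEmpty_or_nonempty V with h | h
  · simp
  · simp only [SimpleGraph.complete_graph_degree, Finset.sum_const, Finset.card_univ, nsmul_eq_mul]
    rw [Nat.cast_sub Fintype.card_pos, Nat.cast_one]

lemma laplacianTrace_extendByCliques (G₀ : SimpleGraph V) (d p q k : ℕ) :
    laplacianTrace (extendByCliques G₀ d p q) (k + 1) = laplacianTrace G₀ (k + 1) +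
      (p * (d + 1) * (d * ((d : ℝ) + 1) ^ k) + q * d * (((d : ℝ) - 1) * (d : ℝ) ^ k)) := by
  rw [extendByCliques, laplacianTrace_sum, laplacianTrace_sum, laplacianTrace_disjointCopies,
    laplacianTrace_disjointCopies, laplacianTrace_top_succ (V := Fin (d + 1)) k,
    laplacianTrace_top_succ (V := Fin d) k, laplacianTrace_top_one, laplacianTrace_top_one]
  simp only [Fintype.card_fin]
  push_cast
  ring

lemma degree_extendByCliques_le (G₀ : SimpleGraph V) [DecidableRel G₀.Adj] {d : ℕ}
    (h : ∀ v, G₀.degree v ≤ d) (p q : ℕ) [DecidableRel (extendByCliques G₀ d p q).Adj] (x) :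
    (extendByCliques G₀ d p q).degree x ≤ d := by
  classical
  have hK : ∀ (p r : ℕ) (x : Fin p × Fin r), r ≤ d + 1 →
      (disjointCopies p (⊤ : SimpleGraph (Fin r))).degree x ≤ d := by
    rintro p r ⟨i, v⟩ hr
    have hsub : (disjointCopies p (⊤ : SimpleGraph (Fin r))).neighborFinset (i, v) ⊆
        (Finset.univ.erase v).image fun w => (i, w) := by
      rintro ⟨j, w⟩ hw
      rw [SimpleGraph.mem_neighborFinset] at hw
      obtain ⟨h1, h2⟩ := hw
      simp only at h1 h2
      subst h1
      simpa [eq_comm] using h2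
    have := (Finset.card_le_card hsub).trans Finset.card_image_le
    rw [SimpleGraph.card_neighborFinset_eq_degree, Finset.card_erase_of_mem
      (Finset.mem_univ v), Finset.card_univ, Fintype.card_fin] at this
    omega
  -- Degrees in the disjoint union are read off the diagonal of the block Laplacian.
  have hx := lapMatrix_apply_self ℝ (extendByCliques G₀ d p q) x
  have hsum : (extendByCliques G₀ d p q).lapMatrix ℝ = fromBlocks (G₀.lapMatrix ℝ) 0 0
      (fromBlocks ((disjointCopies p (⊤ : SimpleGraph (Fin (d + 1)))).lapMatrix ℝ) 0 0
        ((disjointCopies q (⊤ : SimpleGraph (Fin d))).lapMatrix ℝ)) := by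
    rw [← lapMatrix_sum, ← lapMatrix_sum]
    congr!
  rw [hsum] at hx
  rcases x with v | x | x
  · rw [fromBlocks_apply₁₁, lapMatrix_apply_self, Nat.cast_inj] at hx
    rw [← hx]
    exact h v
  · rw [fromBlocks_apply₂₂, fromBlocks_apply₁₁, lapMatrix_apply_self, Nat.cast_inj] at hx
    rw [← hx]
    exact hK p (d + 1) x le_rfl
  · rw [fromBlocks_apply₂₂, fromBlocks_apply₂₂, lapMatrix_apply_self, Nat.cast_inj] at hx
    rw [← hx]
    exact hK q d x (Nat.le_succ d)

lemma SimpleGraph.eq_bot_or_eq_top_of_card_eq_two (hV : Fintype.card V = 2) (G : SimpleGraph V) :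
    G = ⊥ ∨ G = ⊤ := by
  classical
  by_cases h : ∃ a b, G.Adj a b
  · obtain ⟨a, b, hab⟩ := h
    right
    have huniv : ({a, b} : Finset V) = Finset.univ :=
      Finset.eq_univ_of_card _ (by rw [Finset.card_pair hab.ne, hV])
    have hmem : ∀ x, x = a ∨ x = b := fun x => by
      have := Finset.mem_univ x
      rw [← huniv] at this
      simpa using this
    ext x y
    rw [SimpleGraph.top_adj]
    refine ⟨fun h => h.ne, fun hne => ?_⟩
    rcases hmem x with rfl | rfl <;> rcases hmem y with rfl | rfl
    · exact absurd rfl hne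
    · exact hab
    · exact hab.symm
    · exact absurd rfl hne
  · left
    push Not at h
    ext x y
    simpa using h x y

/-- On two vertices the edge count determines all traces; this settles the boundary case `d = 1`, `n
= 2` of the main theorem. -/
lemma laplacianTrace_succ_of_card_eq_two (hV : Fintype.card V = 2) (G : SimpleGraph V) (k : ℕ) :
    laplacianTrace G (k + 1) = 2 ^ k * laplacianTrace G 1 := by
  classical
  rcases G.eq_bot_or_eq_top_of_card_eq_two hV with rfl | rfl
  · rw [laplacianTrace_eq_trace_pow, laplacianTrace_eq_trace_pow, lapMatrix_bot]
    simp
  · rw [laplacianTrace_top_succ, hV]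
    norm_num

lemma laplacianTrace_congr {G : SimpleGraph V} {H : SimpleGraph W} (φ : G ≃g H) (k : ℕ) :
    laplacianTrace G k = laplacianTrace H k := by
  classical
  have hL : G.lapMatrix ℝ = reindexAlgEquiv ℝ ℝ φ.toEquiv.symm (H.lapMatrix ℝ) := by
    ext i j
    rw [coe_reindexAlgEquiv, reindex_apply, submatrix_apply]
    by_cases hij : i = j
    · subst hij
      simp [lapMatrix_apply_self]
    · simp [SimpleGraph.lapMatrix, SimpleGraph.degMatrix, hij, φ.map_adj_iff]
  rw [laplacianTrace_eq_trace_pow, hL, ← map_pow, laplacianTrace_eq_trace_pow, trace, trace]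
  exact Equiv.sum_comp φ.toEquiv fun i => (H.lapMatrix ℝ ^ k) i i

omit [Fintype V] [Fintype W] in
lemma ncard_edgeSet_congr {G : SimpleGraph V} {H : SimpleGraph W} (φ : G ≃g H) :
    G.edgeSet.ncard = H.edgeSet.ncard := by
  rw [← Nat.card_coe_set_eq, ← Nat.card_coe_set_eq]
  exact Nat.card_congr φ.mapEdgeSet

/-- The classes live on a fixed vertex set; this lets `H` be compared with `G₀(p,q)` on the vertex
set of the latter. -/
lemma map_mem_lexMinClass_iff (e : V ≃ W) (m k : ℕ) (G : SimpleGraph V) :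
    G.map e.toEmbedding ∈ lexMinClass W m k ↔ G ∈ lexMinClass V m k := by
  induction k generalizing G with
  | zero =>
    change _ = m ↔ _ = m
    rw [ncard_edgeSet_congr (SimpleGraph.Iso.map e G)]
    rfl
  | succ k ih =>
    rcases k with _ | k
    · exact ih G
    · have htr : ∀ K : SimpleGraph V, laplacianTrace (K.map e.toEmbedding) (k + 2) =
          laplacianTrace K (k + 2) := fun K =>
        (laplacianTrace_congr (SimpleGraph.Iso.map e K) _).symm
      have hsurj : ∀ K : SimpleGraph W, ∃ K' : SimpleGraph V, K'.map e.toEmbedding = K :=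
        fun K => ⟨K.map e.symm.toEmbedding, by
          rw [SimpleGraph.map_map]
          have : e.toEmbedding ∘ e.symm.toEmbedding = id := by
            ext x; simp
          rw [this, SimpleGraph.map_id]⟩
      change (_ ∧ ∀ K ∈ lexMinClass W m (k + 1), _) ↔ (_ ∧ ∀ K ∈ lexMinClass V m (k + 1), _)
      rw [ih G, htr]
      refine and_congr_right fun _ => ⟨fun h K hK => ?_, fun h K hK => ?_⟩
      · rw [← htr K]
        exact h _ ((ih K).2 hK)
      · obtain ⟨K', rfl⟩ := hsurj K
        rw [htr K']
        exact h _ ((ih K').1 hK)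

lemma mem_lexMinClass_or_exists_lt {m : ℕ} {G H : SimpleGraph V} (c : ℕ)
    (hG : G ∈ lexMinClass V m (c + 1)) (hH : H.edgeSet.ncard = m) :
    (H ∈ lexMinClass V m (c + 1) ∧ ∀ j, j < c + 1 →
        laplacianTrace H (j + 1) = laplacianTrace G (j + 1)) ∨
      ∃ k, 1 ≤ k ∧ k ≤ c ∧ (∀ j, j < k → laplacianTrace H (j + 1) = laplacianTrace G (j + 1)) ∧
        laplacianTrace G (k + 1) < laplacianTrace H (k + 1) := by
  classical
  induction c with
  | zero =>
    refine Or.inl ⟨hH, fun j hj => ?_⟩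
    obtain rfl : j = 0 := by omega
    have hG' : G.edgeSet.ncard = m := hG
    rw [zero_add, laplacianTrace_one, laplacianTrace_one, sum_degree_eq_two_mul_ncard,
      sum_degree_eq_two_mul_ncard, hH, hG']
  | succ c ih =>
    rcases ih hG.1 with ⟨hmem, heq⟩ | ⟨k, h1, h2, h3, h4⟩
    · rcases (hG.2 H hmem).lt_or_eq with hlt | he
      · exact Or.inr ⟨c + 1, by omega, le_rfl, heq, hlt⟩
      · refine Or.inl ⟨⟨hmem, fun K hK => he ▸ hG.2 K hK⟩, fun j hj => ?_⟩
        rcases Nat.lt_succ_iff_lt_or_eq.1 hj with h | rfl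
        · exact heq j h
        · exact he.symm
    · exact Or.inr ⟨k, h1, by omega, h3, h4⟩

end LaplacianTraces

/-! ### Comparing products through power sums; the convexity bound -/

section PowerSums

/-- The expansion of `log ∏ (1 - z i / n)` in the power sums of `z`. -/
lemma hasSum_powerSum_div {ι : Type*} [Fintype ι] {n : ℝ} (hn : 0 < n) (z : ι → ℝ)
    (hz0 : ∀ i, 0 ≤ z i) (hzn : ∀ i, z i < n) :
    HasSum (fun j : ℕ => (∑ i, z i ^ (j + 1)) / ((j + 1) * n ^ (j + 1)))
      (Fintype.card ι * Real.log n - Real.log (∏ i, (n - z i))) := by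
  have h : ∀ i ∈ Finset.univ, HasSum (fun j : ℕ => (z i / n) ^ (j + 1) / ((j : ℝ) + 1))
      (-Real.log (1 - z i / n)) := fun i _ =>
    Real.hasSum_pow_div_log_of_abs_lt_one (by
      rw [abs_of_nonneg (div_nonneg (hz0 i) hn.le), div_lt_one hn]
      exact hzn i)
  convert hasSum_sum h using 1
  · funext j
    rw [Finset.sum_div]
    refine Finset.sum_congr rfl fun i _ => ?_
    rw [div_pow, div_div, mul_comm]
  · have h1 : ∀ i, -Real.log (1 - z i / n) = Real.log n - Real.log (n - z i) := by
      intro i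
      have h2 : 1 - z i / n = (n - z i) / n := by field_simp
      rw [h2, Real.log_div (sub_pos.2 (hzn i)).ne' hn.ne']
      ring
    rw [Finset.sum_congr rfl fun i _ => h1 i, Finset.sum_sub_distrib,
      Real.log_prod fun i _ => (sub_pos.2 (hzn i)).ne']
    simp

/-- If the power sums of `x` and `y` first differ at the exponent `k + 1`, where that of `y` is
larger by at least `1`, and the later power sums of `x` do not exceed those of `y` by much, then
`∏ (n - y i) < ∏ (n - x i)`. -/
lemma prod_sub_lt_prod_sub {ι κ : Type*} [Fintype ι] [Fintype κ] {n B N : ℝ} {k : ℕ}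
    {x : ι → ℝ} {y : κ → ℝ} (hcard : Fintype.card κ = Fintype.card ι) (hn : 0 < n)
    (hx0 : ∀ i, 0 ≤ x i) (hxn : ∀ i, x i < n) (hy0 : ∀ i, 0 ≤ y i) (hyn : ∀ i, y i ≤ n)
    (hB : 0 ≤ B) (hN : 0 ≤ N) (hBn : B < n)
    (heq : ∀ j, j < k → ∑ i, y i ^ (j + 1) = ∑ i, x i ^ (j + 1))
    (hlt : ∑ i, x i ^ (k + 1) + 1 ≤ ∑ i, y i ^ (k + 1))
    (hgt : ∀ j, ∑ i, x i ^ (j + 1) ≤ ∑ i, y i ^ (j + 1) + N * B ^ (j + 1))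
    (hlarge : B + N * B ^ (k + 2) ≤ n) :
    ∏ i, (n - y i) < ∏ i, (n - x i) := by
  have hpos : 0 < ∏ i, (n - x i) := Finset.prod_pos fun i _ => sub_pos.2 (hxn i)
  -- If some `y i` equals `n`, the left product vanishes; otherwise logarithms are available.
  by_cases hyn' : ∃ i, y i = n
  · obtain ⟨i, hi⟩ := hyn'
    rwa [Finset.prod_eq_zero (Finset.mem_univ i) (by rw [hi, sub_self])]
  push Not at hyn'
  have hyn : ∀ i, y i < n := fun i => lt_of_le_of_ne (hyn i) (hyn' i)
  have hposy : 0 < ∏ i, (n - y i) := Finset.prod_pos fun i _ => sub_pos.2 (hyn i)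
  rw [← Real.log_lt_log_iff hposy hpos]
  have hdiff := (hasSum_powerSum_div hn y hy0 hyn).sub (hasSum_powerSum_div hn x hx0 hxn)
  rw [hcard] at hdiff
  have htail := (hasSum_nat_add_iff' (k + 1)).2 hdiff
  -- The tail starts at exponent `k + 2`, so every factor `1 / (m + 1)` in it is at most `1 / (k +
  -- 2)`, leaving a geometric series of ratio `B / n`.
  have hgeom := (hasSum_geometric_of_lt_one (div_nonneg hB hn.le)
    ((div_lt_one hn).2 hBn)).mul_left (-(N / (k + 2) * (B / n) ^ (k + 2)))
  have hle := hasSum_le (fun j => ?_) hgeom htail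
  · rw [Finset.sum_range_succ, Finset.sum_eq_zero fun j hj => by
      rw [heq j (Finset.mem_range.1 hj), sub_self], zero_add] at hle
    have hk : 1 / ((k + 1) * n ^ (k + 1)) ≤ (∑ i, y i ^ (k + 1)) / ((k + 1) * n ^ (k + 1)) -
        (∑ i, x i ^ (k + 1)) / ((k + 1) * n ^ (k + 1)) := by
      rw [← sub_div]
      gcongr
      linarith
    -- `hlarge` says `N B^(k+2) ≤ n - B`, which bounds the possible tail loss by `1 / ((k+2)
    -- n^(k+1))`, strictly below the gain `1 / ((k+1) n^(k+1))`.
    have hNB : N / (k + 2) * (B / n) ^ (k + 2) * (1 - B / n)⁻¹ ≤ 1 / ((k + 2) * n ^ (k + 1)) := by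
      have hnB : 0 < n - B := sub_pos.2 hBn
      have h1 : N / (k + 2) * (B / n) ^ (k + 2) * (1 - B / n)⁻¹ =
          1 / ((k + 2) * n ^ (k + 1)) * (N * B ^ (k + 2) / (n - B)) := by
        have h2 : 1 - B / n = (n - B) / n := by field_simp
        rw [h2, inv_div, div_pow]
        field_simp
        ring
      rw [h1]
      refine mul_le_of_le_one_right (by positivity) ?_
      rw [div_le_one hnB]
      linarith
    have hkk : 1 / (((k : ℝ) + 2) * n ^ (k + 1)) < 1 / ((k + 1) * n ^ (k + 1)) := by
      gcongr
      norm_num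
    rw [neg_mul] at hle
    linarith
  · have hj := hgt (j + (k + 1))
    set m : ℕ := j + (k + 1) with hm
    rw [← sub_div]
    have hmk : (k : ℝ) + 2 ≤ (m : ℝ) + 1 := by
      rw [hm]
      push_cast
      have : (0 : ℝ) ≤ j := Nat.cast_nonneg j
      linarith
    have h1 : -(N * B ^ (m + 1)) / (((m : ℝ) + 1) * n ^ (m + 1)) ≤
        (∑ i, y i ^ (m + 1) - ∑ i, x i ^ (m + 1)) / (((m : ℝ) + 1) * n ^ (m + 1)) := by
      gcongr
      linarith
    refine le_trans ?_ h1
    rw [neg_div, neg_mul, neg_le_neg_iff]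
    calc N * B ^ (m + 1) / (((m : ℝ) + 1) * n ^ (m + 1))
        ≤ N * B ^ (m + 1) / (((k : ℝ) + 2) * n ^ (m + 1)) := by gcongr
      _ = N / (k + 2) * (B / n) ^ (m + 1) := by rw [div_pow]; field_simp
      _ = N / (k + 2) * (B / n) ^ (k + 2) * (B / n) ^ j := by
        rw [mul_assoc, ← pow_add]
        congr 2
        omega

/-- The supporting line of the convex function `x ↦ x (x + 1) ^ k` through its values at `d - 1`
and `d` lies below its values at the natural numbers. -/
lemma exists_line_le_mul_pow (d k : ℕ) :
    ∃ a b : ℝ, (∀ x : ℕ, a + b * x ≤ (x : ℝ) * ((x : ℝ) + 1) ^ k) ∧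
      a + b * d = (d : ℝ) * ((d : ℝ) + 1) ^ k ∧
      ∀ y : ℕ, y + 1 = d → a + b * y = (y : ℝ) * ((y : ℝ) + 1) ^ k := by
  rcases d with _ | d
  · refine ⟨0, 0, fun x => ?_, by simp, by simp⟩
    simp only [zero_mul, add_zero]
    positivity
  set f : ℝ → ℝ := fun x => x * (x + 1) ^ k with hf
  have hconv : ConvexOn ℝ (Set.Ici 0) f := by
    have h1 : ConvexOn ℝ (Set.Ici (0 : ℝ)) fun x => x := convexOn_id (convex_Ici 0)
    have h2 : ConvexOn ℝ (Set.Ici (0 : ℝ)) fun x => (x + 1) ^ k := by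
      have h := (h1.add (convexOn_const (1 : ℝ) (convex_Ici 0))).pow
        (fun x hx => add_nonneg (Set.mem_Ici.1 hx) zero_le_one) k
      exact h
    refine h1.mul h2 (fun x hx => hx) (fun x hx => ?_) ?_
    · have := Set.mem_Ici.1 hx
      positivity
    · refine MonotoneOn.monovaryOn (fun x _ y _ h => h) fun x hx y hy h => ?_
      have := Set.mem_Ici.1 hx
      gcongr
  -- After the case split the chord passes through `d` and `d + 1`. No natural number lies strictly
  -- between them, and elsewhere monotone slopes put the chord below `f`.
  refine ⟨f d - (f (d + 1) - f d) * d, f (d + 1) - f d, fun x => ?_, ?_, ?_⟩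
  · change _ ≤ f x
    rcases lt_trichotomy x d with h | rfl | h
    · have hxd : (x : ℝ) < d := by exact_mod_cast h
      have := hconv.slope_mono_adjacent (x := x) (y := d) (z := d + 1)
        (Set.mem_Ici.2 (Nat.cast_nonneg x)) (Set.mem_Ici.2 (by positivity)) hxd (lt_add_one _)
      rw [add_sub_cancel_left, div_one, div_le_iff₀ (sub_pos.2 hxd)] at this
      linarith
    · exact le_of_eq (by ring)
    · rcases (Nat.succ_le_of_lt h).eq_or_lt with rfl | h'
      · refine le_of_eq ?_
        push_cast
        ring
      · have hxd : (d : ℝ) + 1 < x := by exact_mod_cast h'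
        have := hconv.slope_mono_adjacent (x := d) (y := d + 1) (z := x)
          (Set.mem_Ici.2 (Nat.cast_nonneg d)) (Set.mem_Ici.2 (by positivity)) (lt_add_one _) hxd
        rw [add_sub_cancel_left, div_one, le_div_iff₀ (sub_pos.2 hxd)] at this
        linarith
  · simp only [hf]
    push_cast
    ring
  · intro y hy
    obtain rfl : y = d := by omega
    simp only [hf]
    ring

end PowerSums

/-! ### Comparing the traces of `G₀(p,q)` with those of any competitor -/

section Comparison

variable {V W : Type*} [Fintype V] [Fintype W]

lemma laplacianTrace_le_card_mul_pow (G : SimpleGraph V) [DecidableRel G.Adj] {d : ℕ}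
    (hd : ∀ v, G.degree v ≤ d) (k : ℕ) :
    laplacianTrace G k ≤ Fintype.card V * (2 * (d : ℝ)) ^ k := by
  rw [laplacianTrace_eq_sum, ← Finset.card_univ, ← nsmul_eq_mul]
  exact Finset.sum_le_card_nsmul _ _ _ fun i _ =>
    pow_le_pow_left₀ (lapEigenvalues_nonneg G i) (lapEigenvalues_le_two_mul G hd i) k

lemma laplacianTrace_extendByCliques_le (G₀ : SimpleGraph V) [DecidableRel G₀.Adj] {d : ℕ}
    (hdeg : ∀ v, G₀.degree v = d ∨ G₀.degree v + 1 = d) (p q : ℕ) (H : SimpleGraph W)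
    (hvert : Fintype.card W = Fintype.card V + (p * (d + 1) + q * d))
    (hone : laplacianTrace H 1 = laplacianTrace (extendByCliques G₀ d p q) 1) (k : ℕ) :
    laplacianTrace (extendByCliques G₀ d p q) (k + 1) ≤
      laplacianTrace H (k + 1) + Fintype.card V * (2 * (d : ℝ)) ^ (k + 1) := by
  classical
  obtain ⟨a, b, hle, hd, hd'⟩ := exists_line_le_mul_pow d k
  have hH : a * Fintype.card W + b * laplacianTrace H 1 ≤ laplacianTrace H (k + 1) := by
    refine le_trans (le_of_eq ?_) ((Finset.sum_le_sum fun w _ => hle (H.degree w)).trans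
      (sum_degree_mul_pow_le_laplacianTrace H k))
    rw [Finset.sum_add_distrib, ← Finset.mul_sum, laplacianTrace_one]
    simp [mul_comm]
  -- The line is exact at the degrees `d - 1` and `d` of `G₀`, where its values are nonnegative, so
  -- the share of `G₀` can be dropped from the lower bound for `H`.
  have hG₀ : 0 ≤ a * Fintype.card V + b * laplacianTrace G₀ 1 := by
    have : 0 ≤ ∑ v, (a + b * (G₀.degree v : ℝ)) := by
      refine Finset.sum_nonneg fun v _ => ?_
      rcases hdeg v with h | h
      · rw [h, hd]
        positivity
      · rw [hd' _ h]
        positivity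
    rw [Finset.sum_add_distrib, ← Finset.mul_sum, ← laplacianTrace_one] at this
    simpa [mul_comm] using this
  -- The line is exact on the copies of `K_d`; for `d = 0` the factor `d` removes the meaningless
  -- degree `-1`.
  have hcl : (q : ℝ) * d * (a + b * ((d : ℝ) - 1)) = q * d * (((d : ℝ) - 1) * (d : ℝ) ^ k) := by
    rcases d with _ | d
    · simp
    · have := hd' d rfl
      push_cast
      rw [add_sub_cancel_right, this]
  have h1 := laplacianTrace_extendByCliques G₀ d p q 0
  have h2 := laplacianTrace_extendByCliques G₀ d p q k
  have h3 := laplacianTrace_le_card_mul_pow G₀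
    (fun v => (by rcases hdeg v with h | h <;> omega : G₀.degree v ≤ d)) (k + 1)
  simp only [zero_add, pow_zero, mul_one] at h1
  rw [hone, h1, hvert] at hH
  push_cast at hH
  rw [h2, ← hcl, ← hd]
  nlinarith [hH, hG₀, h3]

/-- The spectrum of a union of copies of `K_{d+1}` and `K_d` lies in `{0, d, d+1}`. The traces alone
show it: `x (x - d)² (x - d - 1)²` is nonnegative on the spectrum and sums to zero. -/
lemma lapEigenvalues_extendByCliques_le [IsEmpty V] (G₀ : SimpleGraph V) (d p q : ℕ) (i) :
    lapEigenvalues (extendByCliques G₀ d p q) i ≤ d + 1 := by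
  set x := lapEigenvalues (extendByCliques G₀ d p q) with hx
  have htr : ∀ k, ∑ i, x i ^ (k + 1) =
      p * (d + 1) * (d * ((d : ℝ) + 1) ^ k) + q * d * (((d : ℝ) - 1) * (d : ℝ) ^ k) := by
    intro k
    have h0 : laplacianTrace G₀ (k + 1) = 0 := by
      rw [laplacianTrace_eq_sum]
      simp
    rw [hx, ← laplacianTrace_eq_sum, laplacianTrace_extendByCliques, h0, zero_add]
  have hnonneg : ∀ i ∈ Finset.univ, 0 ≤ x i * ((x i - d) * (x i - (d + 1))) ^ 2 := fun i _ =>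
    mul_nonneg (lapEigenvalues_nonneg _ i) (sq_nonneg _)
  have hsum : ∑ i, x i * ((x i - d) * (x i - (d + 1))) ^ 2 = 0 := by
    have hexp : ∀ i, x i * ((x i - d) * (x i - (d + 1))) ^ 2 =
        x i ^ (4 + 1) - 2 * (2 * d + 1) * x i ^ (3 + 1) +
          ((2 * d + 1) ^ 2 + 2 * (d * (d + 1))) * x i ^ (2 + 1) -
          2 * (2 * d + 1) * (d * (d + 1)) * x i ^ (1 + 1) + (d * (d + 1)) ^ 2 * x i ^ (0 + 1) := by
      intro i; ring
    simp only [hexp, Finset.sum_add_distrib, Finset.sum_sub_distrib, ← Finset.mul_sum, htr]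
    ring
  have hzero := (Finset.sum_eq_zero_iff_of_nonneg hnonneg).1 hsum i (Finset.mem_univ i)
  have hd : (0 : ℝ) ≤ d := Nat.cast_nonneg d
  rcases mul_eq_zero.1 hzero with h | h
  · rw [h]
    linarith
  · rcases mul_eq_zero.1 (pow_eq_zero_iff two_ne_zero |>.1 h) with h | h <;> linarith

end Comparison

/-! ### The main theorem -/

theorem theorem4p4 {V₀ : Type*} [Fintype V₀] (G₀ : SimpleGraph V₀) [DecidableRel G₀.Adj]
    (c d : ℕ) (hc : 1 ≤ c)
    (hdeg : ∀ v, G₀.degree v = d ∨ G₀.degree v + 1 = d)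
    (hmin : ∀ p q : ℕ, extendByCliques G₀ d p q ∈
      lexMinClass (V₀ ⊕ ((Fin p × Fin (d + 1)) ⊕ (Fin q × Fin d)))
        (extendByCliques G₀ d p q).edgeSet.ncard (c + 1))
    (p q : ℕ) {W : Type*} [Fintype W] (H : SimpleGraph W)
    (hvert : Fintype.card W =
      Fintype.card (V₀ ⊕ ((Fin p × Fin (d + 1)) ⊕ (Fin q × Fin d))))
    (hedge : H.edgeSet.ncard = (extendByCliques G₀ d p q).edgeSet.ncard)
    (hH : H ∉ lexMinClass W (extendByCliques G₀ d p q).edgeSet.ncard (c + 1))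
    (hlarge : 2 * d + Fintype.card V₀ * (2 * d) ^ (c + 2) ≤ Fintype.card W) :
    spanningTreeCount Hᶜ < spanningTreeCount (extendByCliques G₀ d p q)ᶜ := by
  classical
  set G := extendByCliques G₀ d p q with hG
  obtain ⟨k, hk1, hkc, heq, hlt⟩ : ∃ k, 1 ≤ k ∧ k ≤ c ∧
      (∀ j, j < k → laplacianTrace H (j + 1) = laplacianTrace G (j + 1)) ∧
        laplacianTrace G (k + 1) < laplacianTrace H (k + 1) := by
    let e := Fintype.equivOfCardEq hvert
    have htr := fun j => laplacianTrace_congr (SimpleGraph.Iso.map e H) j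
    simp only [htr]
    refine (mem_lexMinClass_or_exists_lt c (hmin p q) ?_).resolve_left fun h =>
      hH ((map_mem_lexMinClass_iff e _ _ H).1 h.1)
    rw [← ncard_edgeSet_congr (SimpleGraph.Iso.map e H), hedge]
  have hone : laplacianTrace H 1 = laplacianTrace G 1 := heq 0 hk1
  have hWpos : 0 < Fintype.card W := by
    rw [Fintype.card_pos_iff]
    by_contra h
    rw [not_nonempty_iff] at h
    have : IsEmpty (V₀ ⊕ ((Fin p × Fin (d + 1)) ⊕ (Fin q × Fin d))) := by
      rw [← Fintype.card_eq_zero_iff, ← hvert, Fintype.card_eq_zero]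
    rw [laplacianTrace_eq_sum, laplacianTrace_eq_sum] at hlt
    simp at hlt
  have : Nonempty W := Fintype.card_pos_iff.1 hWpos
  have : Nonempty (V₀ ⊕ ((Fin p × Fin (d + 1)) ⊕ (Fin q × Fin d))) :=
    Fintype.card_pos_iff.1 (hvert ▸ hWpos)
  have hn : (0 : ℝ) < Fintype.card W := by exact_mod_cast hWpos
  have hdeg' : ∀ v, G₀.degree v ≤ d := fun v => by rcases hdeg v with h | h <;> omega
  have hgt : ∀ j, laplacianTrace G (j + 1) ≤ laplacianTrace H (j + 1) +
      Fintype.card V₀ * (2 * (d : ℝ)) ^ (j + 1) :=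
    laplacianTrace_extendByCliques_le G₀ hdeg p q H (by simpa using hvert) hone
  have hxn : ∀ i, lapEigenvalues G i < Fintype.card W := by
    intro i
    -- The bound `2d` on eigenvalues suffices unless `n = 2d`. That equality forces `G₀` to be
    -- empty, where `d + 1` bounds the eigenvalues and is below `2d` for `d ≥ 2`; with `d = 1` there
    -- are two vertices and no strict trace inequality is possible.
    rcases (Nat.le_of_add_right_le hlarge).lt_or_eq with h | h
    · refine (lapEigenvalues_le_two_mul G (degree_extendByCliques_le G₀ hdeg' p q) i).trans_lt ?_
      exact_mod_cast h
    · have hV₀ : IsEmpty V₀ := by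
        rw [← Fintype.card_eq_zero_iff]
        by_contra h0
        have : 0 < Fintype.card V₀ * (2 * d) ^ (c + 2) :=
          Nat.mul_pos (Nat.pos_of_ne_zero h0) (Nat.pow_pos (by omega))
        omega
      refine (lapEigenvalues_extendByCliques_le G₀ d p q i).trans_lt ?_
      rcases Nat.lt_or_ge d 2 with h2 | h2
      · have hW2 : Fintype.card W = 2 := by omega
        rw [laplacianTrace_succ_of_card_eq_two hW2, laplacianTrace_succ_of_card_eq_two
          (hvert ▸ hW2), hone] at hlt
        exact absurd hlt (lt_irrefl _)
      · rw [← h]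
        exact_mod_cast (by omega : d + 1 < 2 * d)
  have hprod : ∏ i, ((Fintype.card W : ℝ) - lapEigenvalues H i) <
      ∏ i, ((Fintype.card W : ℝ) - lapEigenvalues G i) := by
    have hlt' := laplacianTrace_add_one_le hlt
    simp only [laplacianTrace_eq_sum] at heq hlt' hgt
    rcases Nat.eq_zero_or_pos (Fintype.card V₀) with h0 | h0
    -- With `G₀` empty there is no error term; `B = 0` avoids the requirement `2d < n`, which may
    -- fail here.
    · refine prod_sub_lt_prod_sub (B := 0) (N := 0) hvert hn (lapEigenvalues_nonneg G) hxn
        (lapEigenvalues_nonneg H) (lapEigenvalues_le_card H) le_rfl le_rfl hn heq hlt' ?_ ?_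
      · simpa [h0] using hgt
      · simp
    · refine prod_sub_lt_prod_sub (B := 2 * d) (N := Fintype.card V₀) hvert hn
        (lapEigenvalues_nonneg G) hxn (lapEigenvalues_nonneg H) (lapEigenvalues_le_card H)
        (by positivity) (by positivity) ?_ heq hlt' hgt ?_
      · have : 2 * d < Fintype.card W := by
          rcases Nat.eq_zero_or_pos d with rfl | hd
          · simpa using hWpos
          · have : 0 < Fintype.card V₀ * (2 * d) ^ (c + 2) :=
              Nat.mul_pos h0 (Nat.pow_pos (by omega))
            omega
        exact_mod_cast this
      -- The first difference occurs at some `k ≤ c`, so the size assumption at exponent `c + 2`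
      -- covers every case.
      · have : (2 * d) ^ (k + 2) ≤ (2 * d) ^ (c + 2) := by
          rcases Nat.eq_zero_or_pos d with rfl | hd
          · simp
          · exact Nat.pow_le_pow_right (by omega) (by omega)
        have := (Nat.add_le_add_left (Nat.mul_le_mul_left (Fintype.card V₀) this) (2 * d)).trans
          hlarge
        exact_mod_cast this
  have hH' := card_sq_mul_spanningTreeCount_compl_eq_prod H
  have hG' := card_sq_mul_spanningTreeCount_compl_eq_prod G
  rw [← hvert] at hG'
  rw [← hH', ← hG'] at hprod
  exact_mod_cast lt_of_mul_lt_mul_left hprod (by positivity)
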